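/- Let $\mathcal H$ be a complex Hilbert space and let $\mathcal B(\mathcal H)$ be the algebra of bounded linear operators on $\mathcal H$ with the usual (Loewner) order. For positive invertible operators $A,B\in\mathcal B(\mathcal H)$ and $v\in[0,1]$ let $$A\sharp_v B=A^{1/2}\left(A^{-1/2}BA^{-1/2}\right)^{v}A^{1/2}$$ be the weighted geometric mean, let $$T_v(A|B)=\frac{A\sharp_v B-A}{v}\quad(0<v\le 1),\qquad T_0(A|B)=S(A|B)=A^{1/2}\log\left(A^{-1/2}BA^{-1/2}\right)A^{1/2}$$ be the Tsallis relative operator entropy (so that $T_0(A|B)=\lim_{v\to0}T_v(A|B)$ is the relative operator entropy). **Theorem.** Let $A,B\in\mathcal B(\mathcal H)$ be positive invertible operators and let $\Phi:\mathcal B(\mathcal H)\to\mathcal B(\mathcal H)$ be a unital positive linear map. For $v\in(0,1]$ and $\mu\in[0,1]$ put $$F_v(\mu)=\frac{\Phi\big((A\sharp_v B)\sharp_\mu A\big)\,\sharp_v\,\Phi\big((A\sharp_v B)\sharp_\mu B\big)-\Phi(A)}{v}.$$ Then, for every $v\in(0,1]$, $F_v$ is Bochner integrable on $[0,1]$ in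 the operator norm. As $v\to0^+$, $F_v(\mu)$ converges in norm, for every $\mu\in[0,1]$, to some $F_0(\mu)$; the function $F_0$ is integrable on $[0,1]$, and $\int_0^1F_v(\mu)\,d\mu\to\int_0^1F_0(\mu)\,d\mu$ in norm. With this reading of the case $v=0$, for every $v\in[0,1]$, $$\Phi\big(T_v(A|B)\big)\le\int_0^1F_v(\mu)\,d\mu\le T_v\big(\Phi(A)|\Phi(B)\big).$$ -/

import Mathlib

open MeasureTheory Filter Topology Set

/-- The weighted operator mean `A ♮ᵥ B = A^{1/2} (A^{-1/2} B A^{-1/2})^v A^{1/2}` of positive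
invertible operators, for real `v`; for `v ∈ [0,1]` it is the weighted geometric mean `A ♯ᵥ B`.
Powers are taken in the continuous functional calculus. -/
noncomputable def opMean {H : Type*} [NormedAddCommGroup H] [InnerProductSpace ℂ H]
    [CompleteSpace H] (v : ℝ) (A B : H →L[ℂ] H) : H →L[ℂ] H :=
  A ^ (1 / 2 : ℝ) * (A ^ (-(1 / 2) : ℝ) * B * A ^ (-(1 / 2) : ℝ)) ^ v * A ^ (1 / 2 : ℝ)

/-- The relative operator entropy
`S(A|B) = A^{1/2} log (A^{-1/2} B A^{-1/2}) A^{1/2}`. -/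
noncomputable def relOpEntropy {H : Type*} [NormedAddCommGroup H] [InnerProductSpace ℂ H]
    [CompleteSpace H] (A B : H →L[ℂ] H) : H →L[ℂ] H :=
  A ^ (1 / 2 : ℝ) * CFC.log (A ^ (-(1 / 2) : ℝ) * B * A ^ (-(1 / 2) : ℝ)) * A ^ (1 / 2 : ℝ)

/-- The Tsallis relative operator entropy `Tᵥ(A|B) = (A ♮ᵥ B - A) / v` for `v ≠ 0`, with
`T₀(A|B) = S(A|B)`, the limit for `v → 0`. -/
noncomputable def tsallisRelOpEntropy {H : Type*} [NormedAddCommGroup H] [InnerProductSpace ℂ H]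
    [CompleteSpace H] (v : ℝ) (A B : H →L[ℂ] H) : H →L[ℂ] H :=
  if v = 0 then relOpEntropy A B else v⁻¹ • (opMean v A B - A)

/-- The integrand
`(Φ((A ♯ᵥ B) ♯_μ A) ♯ᵥ Φ((A ♯ᵥ B) ♯_μ B) - Φ(A)) / v`, meaningful for `v ≠ 0`. -/
noncomputable def entropyIntegrand {H : Type*} [NormedAddCommGroup H] [InnerProductSpace ℂ H]
    [CompleteSpace H] (Φ : (H →L[ℂ] H) →ₚ[ℂ] (H →L[ℂ] H)) (A B : H →L[ℂ] H) (v μ : ℝ) :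
    H →L[ℂ] H :=
  v⁻¹ • (opMean v (Φ (opMean μ (opMean v A B) A)) (Φ (opMean μ (opMean v A B) B)) - Φ A)

open scoped Ring

/-! ### Continuity and derivative of real powers; an operator Cauchy–Schwarz inequality. -/

section CStarAlgebra

variable {A : Type*} [CStarAlgebra A] [PartialOrder A] [StarOrderedRing A]

/-! The curve `t ↦ A ♯ₜ B` behaves like a geodesic (`opMean_opMean_opMean`): the `v`-mean of its
points at `s` and `t` is its point at `s + v(t - s)`. The two arguments of `Φ` in the integrand are
the points at `s = v(1 - μ)` and `t = v + μ(1 - v)`, for which `s + v(t - s) = v` whatever `μ` is.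
Ando's inequality applied to these two points bounds the integrand below by `Φ(Tᵥ(A|B))`. Applied
inside each `Φ`, together with monotonicity of the mean and the geodesic identity for `Φ(A)`,
`Φ(B)`, it bounds the integrand above by `Tᵥ(Φ(A)|Φ(B))`. Both bounds are constant in `μ`, so
integration over `[0,1]` preserves them.

Ando's inequality rests on a chain: Cauchy–Schwarz for finitely many positive elements gives Choi's
inequality, by way of Bernstein polynomials; the integral representation of `x ^ p` turns that into
Jensen's inequality; normalizing `Φ` turns Jensen's inequality into Ando's.

As `v → 0⁺`, the integrand splits into two difference quotients that converge to relative entropies.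
The order bounds give a norm bound uniform in `μ`, so dominated convergence applies and the
inequalities pass to the limit. -/

lemma CFC.rpow_eq_exp_smul_log {a : A} (ha : IsStrictlyPositive a) (y : ℝ) :
    a ^ y = NormedSpace.exp (y • CFC.log a) := by
  have h0 : ∀ x ∈ spectrum ℝ a, 0 < x := fun x hx => ha.spectrum_pos hx
  have hlog : ContinuousOn Real.log (spectrum ℝ a) :=
    Real.continuousOn_log.mono fun x hx => (h0 x hx).ne'
  rw [CFC.rpow_eq_cfc_real ha.nonneg, ← CFC.real_exp_eq_normedSpace_exp
    ((IsSelfAdjoint.all y).smul IsSelfAdjoint.log), CFC.log,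
    ← cfc_smul y Real.log a hlog, ← cfc_comp' Real.exp (fun x => y • Real.log x) a
      (by fun_prop) (hlog.const_smul y)]
  refine cfc_congr fun x hx => ?_
  simp only [smul_eq_mul]
  rw [Real.rpow_def_of_pos (h0 x hx), mul_comm]

lemma Filter.Tendsto.cfcLog {ι : Type*} {l : Filter ι} {a : ι → A} {a₀ : A}
    (h : Tendsto a l (𝓝 a₀)) (ha : ∀ᶠ i in l, IsStrictlyPositive (a i))
    (ha₀ : IsStrictlyPositive a₀) :
    Tendsto (fun i => CFC.log (a i)) l (𝓝 (CFC.log a₀)) := by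
  have := CFC.continuousOn_log (A := A) a₀ ⟨ha₀.isSelfAdjoint, ha₀.isUnit⟩
  refine this.tendsto.comp (tendsto_nhdsWithin_iff.2 ⟨h, ?_⟩)
  filter_upwards [ha] with i hi using ⟨hi.isSelfAdjoint, hi.isUnit⟩

lemma Filter.Tendsto.cfcRpow {ι : Type*} {l : Filter ι} {a : ι → A} {a₀ : A} {y : ι → ℝ} {y₀ : ℝ}
    (h : Tendsto a l (𝓝 a₀)) (ha : ∀ᶠ i in l, IsStrictlyPositive (a i))
    (ha₀ : IsStrictlyPositive a₀) (hy : Tendsto y l (𝓝 y₀)) :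
    Tendsto (fun i => a i ^ y i) l (𝓝 (a₀ ^ y₀)) := by
  rw [CFC.rpow_eq_exp_smul_log ha₀]
  let _ := NormedAlgebra.restrictScalars ℚ ℝ A
  have hc : Continuous (NormedSpace.exp : A → A) := NormedSpace.exp_continuous
  refine ((hc.tendsto _).comp (hy.smul (h.cfcLog ha ha₀))).congr' ?_
  filter_upwards [ha] with i hi using (CFC.rpow_eq_exp_smul_log hi _).symm

/-- This is the derivative of `exp` at `0`, evaluated along `v • c • log (a v)`. The base may move
with `v`, as the main limit requires. -/
lemma Filter.Tendsto.inv_smul_rpow_sub_one {a : ℝ → A} {a₀ : A} (c : ℝ)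
    (h : Tendsto a (𝓝[>] 0) (𝓝 a₀)) (ha : ∀ᶠ v in 𝓝[>] 0, IsStrictlyPositive (a v))
    (ha₀ : IsStrictlyPositive a₀) :
    Tendsto (fun v : ℝ => v⁻¹ • (a v ^ (c * v) - 1)) (𝓝[>] 0) (𝓝 (c • CFC.log a₀)) := by
  have hv : Tendsto (fun v : ℝ => v) (𝓝[>] 0) (𝓝 0) := tendsto_nhdsWithin_of_tendsto_nhds tendsto_id
  have hL : Tendsto (fun v => c • CFC.log (a v)) (𝓝[>] 0) (𝓝 (c • CFC.log a₀)) :=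
    (h.cfcLog ha ha₀).const_smul c
  have hx : Tendsto (fun v => v • (c • CFC.log (a v))) (𝓝[>] 0) (𝓝 (0 : A)) := by
    simpa using hv.smul hL
  have hd : HasFDerivAt (NormedSpace.exp : A → A) (1 : A →L[ℝ] A) 0 := hasFDerivAt_exp_zero
  have ho := (hasFDerivAt_iff_isLittleO_nhds_zero.1 hd).comp_tendsto hx
  have hO : (fun v => v • (c • CFC.log (a v))) =O[𝓝[>] 0] fun v : ℝ => v := by
    simpa using (Asymptotics.isBigO_refl (fun v : ℝ => v) _).smul (hL.isBigO_one ℝ)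
  have ho' := (ho.trans_isBigO hO)
  have h2 := (ho'.tendsto_inv_smul_nhds_zero).add hL
  rw [zero_add] at h2
  refine h2.congr' ?_
  filter_upwards [ha, self_mem_nhdsWithin] with v hv hv0
  have hv0' : v ≠ 0 := (ne_of_gt hv0)
  rw [CFC.rpow_eq_exp_smul_log hv]
  simp only [Function.comp, zero_add, NormedSpace.exp_zero, one_apply_eq_self, smul_sub]
  rw [inv_smul_smul₀ hv0', smul_smul v c, mul_comm v c]
  abel

lemma CFC.rpow_unitary_conj {u a : A} (hu : u ∈ unitary A) (ha : IsStrictlyPositive a) (y : ℝ) :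
    (u * a * star u) ^ y = u * a ^ y * star u := by
  have h0 : ∀ x ∈ spectrum ℝ a, 0 < x := fun x hx => ha.spectrum_pos hx
  have hpos : 0 ≤ u * a * star u := star_right_conjugate_nonneg ha.nonneg u
  let φ := Unitary.conjStarAlgAut ℝ A ⟨u, hu⟩
  have hφ : Continuous φ := by
    change Continuous fun x => u * x * star u
    fun_prop
  have := StarAlgHomClass.map_cfc φ (fun x : ℝ => x ^ y) a
    (ContinuousOn.rpow_const (by fun_prop) fun x hx => Or.inl (h0 x hx).ne') hφ ha.isSelfAdjoint
    hpos.isSelfAdjoint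
  rw [CFC.rpow_eq_cfc_real ha.nonneg, CFC.rpow_eq_cfc_real hpos]
  exact this.symm

/-- A Cauchy–Schwarz inequality for a finite family of positive elements with total mass `M`. -/
lemma sum_smul_mul_inverse_mul_sum_smul_le {ι : Type*} (s : Finset ι) (r : ι → ℝ) (E : ι → A)
    (hE : ∀ i ∈ s, 0 ≤ E i) {M : A} (hM : IsStrictlyPositive M) (hsum : ∑ i ∈ s, E i = M) :
    (∑ i ∈ s, r i • E i) * M⁻¹ʳ * (∑ i ∈ s, r i • E i) ≤ ∑ i ∈ s, r i ^ 2 • E i := by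
  set N := ∑ i ∈ s, r i • E i with hN
  have hNs : IsSelfAdjoint N := by
    rw [hN]
    exact isSelfAdjoint_sum _ fun i hi => (IsSelfAdjoint.all (r i)).smul (hE i hi).isSelfAdjoint
  have hI : IsSelfAdjoint M⁻¹ʳ := hM.ringInverse.isSelfAdjoint
  have h1 : M * M⁻¹ʳ = 1 := Ring.mul_inverse_cancel _ hM.isUnit
  rw [← sub_nonneg]
  -- Completing the square: the defect is a sum of conjugates of the `E i`.
  have key : ∑ i ∈ s, r i ^ 2 • E i - N * M⁻¹ʳ * N =
      ∑ i ∈ s, star (r i • (1 : A) - M⁻¹ʳ * N) * E i * (r i • (1 : A) - M⁻¹ʳ * N) := by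
    have : ∀ i ∈ s, star (r i • (1 : A) - M⁻¹ʳ * N) * E i * (r i • (1 : A) - M⁻¹ʳ * N) =
        r i ^ 2 • E i - (r i • E i) * (M⁻¹ʳ * N) - N * M⁻¹ʳ * (r i • E i)
          + N * M⁻¹ʳ * E i * (M⁻¹ʳ * N) := by
      intro i _
      simp only [star_sub, star_smul, star_one, star_mul, hNs.star_eq, hI.star_eq, star_trivial,
        sub_mul, mul_sub, smul_mul_assoc, mul_smul_comm, one_mul, mul_one, smul_smul, pow_two,
        smul_sub]
      abel
    rw [Finset.sum_congr rfl this, Finset.sum_add_distrib, Finset.sum_sub_distrib,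
      Finset.sum_sub_distrib, ← Finset.sum_mul, ← Finset.mul_sum, ← Finset.sum_mul,
      ← Finset.mul_sum, hsum, ← hN]
    have : N * M⁻¹ʳ * M * (M⁻¹ʳ * N) = N * M⁻¹ʳ * N := by
      rw [mul_assoc (N * M⁻¹ʳ), ← mul_assoc M, h1, one_mul]
    rw [this, mul_assoc]
    abel
  rw [key]
  exact Finset.sum_nonneg fun i hi => star_left_conjugate_nonneg (hE i hi) _

end CStarAlgebra

lemma aeval_bernsteinPolynomial {A : Type*} [Ring A] [Algebra ℝ A] (z : A) (n k : ℕ) :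
    Polynomial.aeval z (bernsteinPolynomial ℝ n k) =
      (n.choose k : ℝ) • (z ^ k * (1 - z) ^ (n - k)) := by
  simp [bernsteinPolynomial, Algebra.smul_def, mul_assoc]

/-! ### Choi's and Jensen's inequalities for unital positive maps. -/

section PositiveMap

lemma PositiveLinearMap.map_algebraMap_real {A B : Type*} [CStarAlgebra A] [PartialOrder A]
    [CStarAlgebra B] [PartialOrder B] {Φ : A →ₚ[ℂ] B} (hΦ : Φ 1 = 1) (r : ℝ) :
    Φ (algebraMap ℝ A r) = algebraMap ℝ B r := by
  rw [Algebra.algebraMap_eq_smul_one, Algebra.algebraMap_eq_smul_one, Φ.map_smul_of_tower, hΦ]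

variable {A B : Type*} [CStarAlgebra A] [PartialOrder A] [StarOrderedRing A]
  [CStarAlgebra B] [PartialOrder B] [StarOrderedRing B]

lemma PositiveLinearMap.map_isStrictlyPositive {Φ : A →ₚ[ℂ] B} (hΦ : Φ 1 = 1) {a : A}
    (ha : IsStrictlyPositive a) : IsStrictlyPositive (Φ a) := by
  nontriviality B
  have : Nontrivial A := by
    by_contra h
    have := not_nontrivial_iff_subsingleton.1 h
    have h1 : (1 : B) = 0 := by rw [← hΦ, Subsingleton.elim (1 : A) 0, map_zero]
    exact one_ne_zero h1
  obtain ⟨r, hr, hra⟩ := (CFC.exists_pos_algebraMap_le_iff ha.isSelfAdjoint).2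
    fun x (hx : x ∈ spectrum ℝ a) => ha.spectrum_pos hx
  refine (isStrictlyPositive_algebraMap hr).of_le ?_
  rw [← map_algebraMap_real hΦ]
  exact Φ.monotone' hra

lemma aeval_bernsteinPolynomial_nonneg {z : A} (h0 : 0 ≤ z) (h1 : z ≤ 1) (n k : ℕ) :
    0 ≤ Polynomial.aeval z (bernsteinPolynomial ℝ n k) := by
  rw [aeval_bernsteinPolynomial]
  refine smul_nonneg (by positivity) (Commute.mul_nonneg (CStarAlgebra.pow_nonneg h0 k)
    (CStarAlgebra.pow_nonneg (sub_nonneg.2 h1) _) ?_)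
  exact (Commute.sub_right (Commute.one_right z) (Commute.refl z)).pow_pow _ _

/-- Choi's inequality `Φ(a)⁻¹ ≤ Φ(a⁻¹)` for unital positive linear maps. -/
lemma PositiveLinearMap.ringInverse_map_le_map_ringInverse {Φ : A →ₚ[ℂ] B} (hΦ : Φ 1 = 1) {a : A}
    (ha : IsStrictlyPositive a) : (Φ a)⁻¹ʳ ≤ Φ a⁻¹ʳ := by
  set w := a⁻¹ʳ with hw
  have hw0 : 0 ≤ w := ha.ringInverse.nonneg
  have haw : a * w = 1 := Ring.mul_inverse_cancel _ ha.isUnit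
  have hwa : w * a = 1 := Ring.inverse_mul_cancel _ ha.isUnit
  have hM := map_isStrictlyPositive hΦ ha
  -- Scaling puts `c • w` in `[0, 1]`; the `+ 1` keeps `c` positive even when `w = 0`.
  set c : ℝ := (‖w‖ + 1)⁻¹ with hc
  have hc0 : 0 < c := by positivity
  obtain ⟨z, hz⟩ : ∃ z, z = c • w := ⟨_, rfl⟩
  have hz0 : 0 ≤ z := hz ▸ smul_nonneg hc0.le hw0
  have hz1 : z ≤ 1 := by
    rw [← CStarAlgebra.norm_le_one_iff_of_nonneg z hz0, hz, norm_smul, Real.norm_of_nonneg hc0.le,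
      hc, inv_mul_le_one₀ (by positivity)]
    linarith
  have hcomm : Commute a z := by
    rw [hz]
    exact Commute.smul_right (haw.trans hwa.symm) c
  have hbound : ∀ n : ℕ, 1 ≤ n → (Φ a)⁻¹ʳ ≤ Φ w + ((n : ℝ)⁻¹ * c⁻¹) • (1 : B) := by
    intro n hn
    have hn0 : (0 : ℝ) < n := by exact_mod_cast hn
    -- The `b k` act as a smoothed spectral resolution of `z`. The elements `Φ (a * b k)` have total
    -- mass `Φ a`, first moment `n c` and second moment `n(n-1)c² Φ(w) + n c`.
    set b : ℕ → A := fun k => Polynomial.aeval z (bernsteinPolynomial ℝ n k) with hb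
    have hF : ∀ k ∈ Finset.range (n + 1), 0 ≤ Φ (a * b k) := fun k _ =>
      Φ.map_nonneg (Commute.mul_nonneg ha.nonneg (aeval_bernsteinPolynomial_nonneg hz0 hz1 n k)
        (by simp only [hb, aeval_bernsteinPolynomial]
            exact ((hcomm.pow_right k).mul_right
              (((Commute.one_right a).sub_right hcomm).pow_right _)).smul_right _))
    have hb0 : ∑ k ∈ Finset.range (n + 1), b k = 1 := by
      simpa using congrArg (Polynomial.aeval z) (bernsteinPolynomial.sum ℝ n)
    have hb1 : ∑ k ∈ Finset.range (n + 1), (k : ℝ) • b k = (n : ℝ) • z := by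
      simpa [hb, ← Nat.cast_smul_eq_nsmul ℝ] using
        congrArg (Polynomial.aeval z) (bernsteinPolynomial.sum_smul ℝ n)
    have hb2 : ∑ k ∈ Finset.range (n + 1), (k : ℝ) ^ 2 • b k =
        ((n : ℝ) * (n - 1)) • (z * z) + (n : ℝ) • z := by
      have h2 : ∑ k ∈ Finset.range (n + 1), ((k : ℝ) * (k - 1)) • b k =
          ((n : ℝ) * (n - 1)) • (z * z) := by
        have h3 := congrArg (Polynomial.aeval z) (bernsteinPolynomial.sum_mul_smul ℝ n)
        -- Truncated subtraction is harmless at `k = 0`, where the factor `k` vanishes.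
        have h4 : ∀ k : ℕ, (((k * (k - 1) : ℕ)) : ℝ) = (k : ℝ) * (k - 1) := by
          rintro (_ | k) <;> simp
        simpa only [hb, map_sum, map_smul, ← Nat.cast_smul_eq_nsmul ℝ, h4, map_pow,
          Polynomial.aeval_X, map_mul, pow_two] using h3
      rw [← h2, ← hb1, ← Finset.sum_add_distrib]
      refine Finset.sum_congr rfl fun k _ => ?_
      rw [← add_smul]
      ring_nf
    have haz : a * z = c • (1 : A) := by rw [hz, mul_smul_comm, haw]
    have hazz : a * (z * z) = c ^ 2 • w := by
      rw [← mul_assoc, haz, hz, smul_mul_smul_comm, one_mul, pow_two]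
    have hs : ∀ r : ℕ → ℝ, ∑ k ∈ Finset.range (n + 1), r k • Φ (a * b k) =
        Φ (a * ∑ k ∈ Finset.range (n + 1), r k • b k) := by
      intro r
      simp only [Finset.mul_sum, map_sum, mul_smul_comm, Φ.map_smul_of_tower]
    have key := sum_smul_mul_inverse_mul_sum_smul_le (Finset.range (n + 1)) (fun k => (k : ℝ))
      (fun k => Φ (a * b k)) hF hM (by rw [← map_sum, ← Finset.mul_sum, hb0, mul_one])
    rw [hs, hs (fun k => (k : ℝ) ^ 2), hb1, hb2, mul_add, mul_smul_comm, mul_smul_comm, haz, hazz, map_add, Φ.map_smul_of_tower, Φ.map_smul_of_tower,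
      Φ.map_smul_of_tower, Φ.map_smul_of_tower, hΦ] at key
    simp only [smul_mul_assoc, mul_smul_comm, one_mul, mul_one, smul_smul] at key
    -- Division by the squared first moment `(n c)²` leaves an error of order `1/n`.
    have hpos : 0 < ((n : ℝ) * c)⁻¹ ^ 2 := by positivity
    have key2 := smul_le_smul_of_nonneg_left key hpos.le
    rw [smul_add, smul_smul, smul_smul, smul_smul] at key2
    have e1 : ((n : ℝ) * c)⁻¹ ^ 2 * (n * c * (n * c)) = 1 := by field_simp
    have e2 : ((n : ℝ) * c)⁻¹ ^ 2 * (n * (n - 1) * c ^ 2) = 1 - (n : ℝ)⁻¹ := by field_simp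
    have e3 : ((n : ℝ) * c)⁻¹ ^ 2 * (n * c) = (n : ℝ)⁻¹ * c⁻¹ := by field_simp
    rw [e1, e2, e3, one_smul] at key2
    refine key2.trans ?_
    gcongr
    rw [sub_smul, one_smul]
    exact sub_le_self _ (smul_nonneg (by positivity) (Φ.map_nonneg hw0))
  have hlim : Tendsto (fun n : ℕ => Φ w + ((n : ℝ)⁻¹ * c⁻¹) • (1 : B)) atTop (𝓝 (Φ w)) := by
    have h1 := (tendsto_inv_atTop_nhds_zero_nat (𝕜 := ℝ)).mul_const c⁻¹
    simpa using (h1.smul_const (1 : B)).const_add (Φ w)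
  exact ge_of_tendsto hlim (eventually_atTop.2 ⟨1, hbound⟩)

/-- The integrand is a constant minus a positive multiple of a resolvent, the form to which Choi's
inequality applies. -/
lemma cfcₙ_rpowIntegrand₀₁_eq {p t : ℝ} (hp : p ∈ Ioo (0 : ℝ) 1) (ht : 0 < t) {x : A} (hx : 0 ≤ x) :
    cfcₙ (Real.rpowIntegrand₀₁ p t) x =
      algebraMap ℝ A (t ^ (p - 1)) - t ^ p • (algebraMap ℝ A t + x)⁻¹ʳ := by
  have h0 : ∀ r ∈ spectrum ℝ x, t + r ≠ 0 := fun r hr =>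
    (add_pos_of_pos_of_nonneg ht (spectrum_nonneg_of_nonneg hx hr)).ne'
  have hadd : ContinuousOn (fun z : ℝ => t + z) (spectrum ℝ x) := by fun_prop
  have hinv : ContinuousOn (fun z : ℝ => (t + z)⁻¹) (spectrum ℝ x) := hadd.inv₀ h0
  have hq : ContinuousOn (Real.rpowIntegrand₀₁ p t) (quasispectrum ℝ x) :=
    (Real.continuousOn_rpowIntegrand₀₁_Ici hp ht).mono fun r hr =>
      quasispectrum_nonneg_of_nonneg x hx r hr
  rw [cfcₙ_eq_cfc hq Real.rpowIntegrand₀₁_zero_right, Real.rpowIntegrand₀₁_eq_sub hp.2.ne ht,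
    cfc_sub (fun _ : ℝ => t ^ (p - 1)) (fun z : ℝ => t ^ p * (t + z)⁻¹) x continuousOn_const
      (continuousOn_const.mul hinv), cfc_const (t ^ (p - 1)) x hx.isSelfAdjoint,
    cfc_const_mul (t ^ p) _ x hinv, cfc_inv (fun z : ℝ => t + z) x h0 hadd hx.isSelfAdjoint,
    cfc_const_add t (fun z : ℝ => z) x continuousOn_id hx.isSelfAdjoint,
    cfc_id' ℝ x hx.isSelfAdjoint]

/-- Jensen's operator inequality `Φ(a ^ p) ≤ Φ(a) ^ p` for unital positive linear maps. -/
lemma PositiveLinearMap.map_rpow_le_rpow_map {Φ : A →ₚ[ℂ] A} (hΦ : Φ 1 = 1) {a : A}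
    (ha : IsStrictlyPositive a) {p : ℝ} (hp : p ∈ Icc (0 : ℝ) 1) : Φ (a ^ p) ≤ Φ a ^ p := by
  have hM := map_isStrictlyPositive hΦ ha
  rcases hp.1.eq_or_lt with h0 | h0
  · rw [← h0, CFC.rpow_zero a ha.nonneg, CFC.rpow_zero _ hM.nonneg, hΦ]
  rcases hp.2.eq_or_lt with h1 | h1
  · rw [h1, CFC.rpow_one a ha.nonneg, CFC.rpow_one _ hM.nonneg]
  let q : NNReal := ⟨p, hp.1⟩
  have hq : q ∈ Ioo (0 : NNReal) 1 := ⟨h0, h1⟩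
  -- One measure serves both `a` and `Φ a`, so the integrals compare pointwise.
  obtain ⟨μ, hμ⟩ := CFC.exists_measure_nnrpow_eq_integral_cfcₙ_rpowIntegrand₀₁ A hq
  obtain ⟨hi₁, he₁⟩ := hμ a ha.nonneg
  obtain ⟨hi₂, he₂⟩ := hμ (Φ a) hM.nonneg
  have hpq : ∀ x : A, x ^ p = x ^ q := fun x => (CFC.nnrpow_eq_rpow (a := x) hq.1).symm
  let T : A →L[ℂ] A := ⟨Φ.toLinearMap, map_continuous Φ⟩
  rw [hpq, hpq, he₁, he₂]
  change T _ ≤ _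
  rw [← T.integral_comp_comm hi₁]
  refine setIntegral_mono_on (T.integrable_comp hi₁) hi₂ measurableSet_Ioi fun t ht => ?_
  have ht' : 0 < t := ht
  change Φ (cfcₙ (Real.rpowIntegrand₀₁ p t) a) ≤ cfcₙ (Real.rpowIntegrand₀₁ p t) (Φ a)
  rw [cfcₙ_rpowIntegrand₀₁_eq ⟨h0, h1⟩ ht' ha.nonneg,
    cfcₙ_rpowIntegrand₀₁_eq ⟨h0, h1⟩ ht' hM.nonneg, map_sub, map_algebraMap_real hΦ,
    Φ.map_smul_of_tower]
  have hta : IsStrictlyPositive (algebraMap ℝ A t + a) :=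
    (isStrictlyPositive_algebraMap ht').add_nonneg ha.nonneg
  have := ringInverse_map_le_map_ringInverse hΦ hta
  rw [map_add, map_algebraMap_real hΦ] at this
  exact sub_le_sub_left (smul_le_smul_of_nonneg_left this (by positivity)) _

end PositiveMap

/-! ### Algebra, monotonicity and limits of the weighted mean. -/

section OpMean

variable {H : Type*} [NormedAddCommGroup H] [InnerProductSpace ℂ H] [CompleteSpace H]
  {A B A' B' D T : H →L[ℂ] H}

lemma isStrictlyPositive_conjugate_rpow (hA : IsStrictlyPositive A) (hB : IsStrictlyPositive B)
    (y : ℝ) : IsStrictlyPositive (A ^ y * B * A ^ y) :=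
  IsStrictlyPositive.conjugate_of_isUnit_of_isSelfAdjoint B (A ^ y) (hA.rpow A y).isUnit
    (hA.rpow A y).isSelfAdjoint hB

lemma isStrictlyPositive_opMean (hA : IsStrictlyPositive A) (hB : IsStrictlyPositive B) (v : ℝ) :
    IsStrictlyPositive (opMean v A B) :=
  isStrictlyPositive_conjugate_rpow hA
    ((isStrictlyPositive_conjugate_rpow hA hB _).rpow _ v) _

lemma rpow_half_mul_rpow_half (hA : IsStrictlyPositive A) :
    A ^ (1 / 2 : ℝ) * A ^ (1 / 2 : ℝ) = A := by
  rw [← CFC.rpow_add hA.isUnit, add_halves, CFC.rpow_one A hA.nonneg]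

/-- The weighted mean computed from an arbitrary factorization `T T*` of its first argument. -/
lemma opMean_mul_star (hT : IsUnit T) (hD : IsStrictlyPositive D) (v : ℝ) :
    opMean v (T * star T) (T * D * star T) = T * D ^ v * star T := by
  have hC : IsStrictlyPositive (T * star T) := by
    simpa using (hT.isStrictlyPositive_star_right_conjugate_iff (a := (1 : H →L[ℂ] H))).2
      isStrictlyPositive_one
  set C := T * star T with hCdef
  set R := C ^ (1 / 2 : ℝ) with hR
  set R' := C ^ (-(1 / 2) : ℝ) with hR'
  have h1 : R * R' = 1 := CFC.rpow_mul_rpow_neg _ hC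
  have h2 : R' * R = 1 := CFC.rpow_neg_mul_rpow _ hC
  have hRR : R * R = C := rpow_half_mul_rpow_half hC
  have hRs : star R' = R' := (hC.rpow C _).isSelfAdjoint.star_eq
  have hRs' : star R = R := (hC.rpow C _).isSelfAdjoint.star_eq
  have hR'u : IsUnit R' := (hC.rpow C _).isUnit
  have hsU : star (R' * T) = star T * R' := by rw [star_mul, hRs]
  have hUU : (R' * T) * star (R' * T) = 1 := by
    rw [hsU]
    calc R' * T * (star T * R') = R' * C * R' := by rw [hCdef]; simp only [mul_assoc]
      _ = (R' * R) * (R * R') := by rw [← hRR]; simp only [mul_assoc]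
      _ = 1 := by rw [h1, h2, one_mul]
  -- Polar decomposition: `C^(-1/2) T` is an invertible coisometry, hence unitary, and powers
  -- commute with unitary conjugation.
  have hU : R' * T ∈ unitary (H →L[ℂ] H) := by
    refine Unitary.mem_iff.2 ⟨?_, hUU⟩
    have hu : IsUnit (R' * T) := hR'u.mul hT
    obtain ⟨u, hu⟩ := hu
    rw [← hu] at hUU ⊢
    rw [Units.mul_eq_one_iff_inv_eq.1 hUU |>.symm]
    exact u.inv_mul
  have hconj : R' * (T * D * star T) * R' = (R' * T) * D * star (R' * T) := by
    rw [hsU]; simp only [mul_assoc]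
  rw [opMean, ← hR, ← hR', hconj, CFC.rpow_unitary_conj hU hD, hsU]
  calc R * (R' * T * D ^ v * (star T * R')) * R
      = (R * R') * T * D ^ v * star T * (R' * R) := by simp only [mul_assoc]
    _ = T * D ^ v * star T := by rw [h1, h2, one_mul, mul_one]

lemma opMean_zero (hA : IsStrictlyPositive A) (hB : IsStrictlyPositive B) : opMean 0 A B = A := by
  rw [opMean, CFC.rpow_zero _ (isStrictlyPositive_conjugate_rpow hA hB _).nonneg, mul_one,
    rpow_half_mul_rpow_half hA]

lemma opMean_one (hA : IsStrictlyPositive A) (hB : IsStrictlyPositive B) : opMean 1 A B = B := by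
  rw [opMean, CFC.rpow_one _ (isStrictlyPositive_conjugate_rpow hA hB _).nonneg]
  have h1 := CFC.rpow_mul_rpow_neg (1 / 2) hA
  have h2 := CFC.rpow_neg_mul_rpow (1 / 2) hA
  calc A ^ (1 / 2 : ℝ) * (A ^ (-(1 / 2) : ℝ) * B * A ^ (-(1 / 2) : ℝ)) * A ^ (1 / 2 : ℝ)
      = (A ^ (1 / 2 : ℝ) * A ^ (-(1 / 2) : ℝ)) * B * (A ^ (-(1 / 2) : ℝ) * A ^ (1 / 2 : ℝ)) := by
        simp only [mul_assoc]
    _ = B := by rw [h1, h2, one_mul, mul_one]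

/-- With `T = A^(1/2) X^(s/2)` the two points become `T T*` and `T X^(t-s) T*`, so only powers of
the single operator `X` remain. -/
lemma opMean_opMean_opMean (hA : IsStrictlyPositive A) (hB : IsStrictlyPositive B) (v s t : ℝ) :
    opMean v (opMean s A B) (opMean t A B) = opMean (s + v * (t - s)) A B := by
  set X := A ^ (-(1 / 2) : ℝ) * B * A ^ (-(1 / 2) : ℝ) with hX
  have hXp : IsStrictlyPositive X := isStrictlyPositive_conjugate_rpow hA hB _
  have hAs : star (A ^ (1 / 2 : ℝ)) = A ^ (1 / 2 : ℝ) := (hA.rpow A _).isSelfAdjoint.star_eq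
  have hXs : star (X ^ (s / 2)) = X ^ (s / 2) := (hXp.rpow X _).isSelfAdjoint.star_eq
  have hT : IsUnit (A ^ (1 / 2 : ℝ) * X ^ (s / 2)) :=
    (hA.rpow A _).isUnit.mul (hXp.rpow X _).isUnit
  have hsT : star (A ^ (1 / 2 : ℝ) * X ^ (s / 2)) = X ^ (s / 2) * A ^ (1 / 2 : ℝ) := by
    rw [star_mul, hAs, hXs]
  have hsplit : ∀ r : ℝ, opMean (s + r) A B =
      A ^ (1 / 2 : ℝ) * X ^ (s / 2) * X ^ r * star (A ^ (1 / 2 : ℝ) * X ^ (s / 2)) := by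
    intro r
    have : s + r = s / 2 + r + s / 2 := by ring
    rw [hsT, opMean, ← hX, this, CFC.rpow_add hXp.isUnit, CFC.rpow_add hXp.isUnit]
    simp only [mul_assoc]
  have hs := hsplit 0
  have ht := hsplit (t - s)
  rw [add_zero, CFC.rpow_zero X hXp.nonneg, mul_one] at hs
  rw [add_sub_cancel] at ht
  rw [hs, ht, opMean_mul_star hT (hXp.rpow X _), hsplit]
  congr 2
  rcases eq_or_ne (t - s) 0 with h | h
  · rw [h, mul_zero, CFC.rpow_zero X hXp.nonneg, CFC.one_rpow]
  · rw [CFC.rpow_rpow X _ _ h hXp, mul_comm]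

lemma opMean_opMean_left (hA : IsStrictlyPositive A) (hB : IsStrictlyPositive B) (v μ : ℝ) :
    opMean μ (opMean v A B) A = opMean (v * (1 - μ)) A B := by
  have := opMean_opMean_opMean hA hB μ v 0
  rw [opMean_zero hA hB] at this
  rw [this]
  ring_nf

lemma opMean_opMean_right (hA : IsStrictlyPositive A) (hB : IsStrictlyPositive B) (v μ : ℝ) :
    opMean μ (opMean v A B) B = opMean (v + μ * (1 - v)) A B := by
  have := opMean_opMean_opMean hA hB μ v 1
  rwa [opMean_one hA hB] at this

lemma opMean_swap (hA : IsStrictlyPositive A) (hB : IsStrictlyPositive B) (v : ℝ) :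
    opMean (1 - v) B A = opMean v A B := by
  have := opMean_opMean_opMean hA hB (1 - v) 1 0
  rw [opMean_one hA hB, opMean_zero hA hB] at this
  rw [this]
  ring_nf

lemma opMean_le_opMean_right (hA : IsStrictlyPositive A) {v : ℝ} (hv : v ∈ Icc (0 : ℝ) 1)
    (h : B ≤ B') : opMean v A B ≤ opMean v A B' := by
  have h1 : ∀ y : ℝ, IsSelfAdjoint (A ^ y) := fun y => (hA.rpow A y).isSelfAdjoint
  exact (h1 _).conjugate_le_conjugate (CFC.monotone_rpow hv ((h1 _).conjugate_le_conjugate h))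

lemma opMean_le_opMean (hA : IsStrictlyPositive A) (hB : IsStrictlyPositive B) {v : ℝ}
    (hv : v ∈ Icc (0 : ℝ) 1) (hAA : A ≤ A') (hBB : B ≤ B') :
    opMean v A B ≤ opMean v A' B' := by
  have hA' := hA.of_le hAA
  refine le_trans ?_ (opMean_le_opMean_right hA' hv hBB)
  -- The swap moves the first argument to the second slot, where Löwner–Heinz applies.
  rw [← opMean_swap hA hB, ← opMean_swap hA' hB]
  exact opMean_le_opMean_right hB ⟨by linarith [hv.2], by linarith [hv.1]⟩ hAA

/-- Ando's inequality `Φ(A ♯ᵥ B) ≤ Φ(A) ♯ᵥ Φ(B)`. -/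
lemma PositiveLinearMap.map_opMean_le {Φ : (H →L[ℂ] H) →ₚ[ℂ] (H →L[ℂ] H)} (hΦ : Φ 1 = 1)
    (hA : IsStrictlyPositive A) (hB : IsStrictlyPositive B) {v : ℝ} (hv : v ∈ Icc (0 : ℝ) 1) :
    Φ (opMean v A B) ≤ opMean v (Φ A) (Φ B) := by
  have hK := map_isStrictlyPositive hΦ hA
  set K := Φ A with hKdef
  have hAs : IsSelfAdjoint (A ^ (1 / 2 : ℝ)) := (hA.rpow A _).isSelfAdjoint
  have hKs : IsSelfAdjoint (K ^ (-(1 / 2) : ℝ)) := (hK.rpow K _).isSelfAdjoint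
  have hKs' : IsSelfAdjoint (K ^ (1 / 2 : ℝ)) := (hK.rpow K _).isSelfAdjoint
  -- Conjugation normalizes `Φ` to a unital map sending `A^(-1/2) B A^(-1/2)` to `K^(-1/2) Φ(B)
  -- K^(-1/2)`.
  let Ψ : (H →L[ℂ] H) →ₚ[ℂ] (H →L[ℂ] H) := PositiveLinearMap.mk₀
    (LinearMap.mulLeftRight ℂ (K ^ (-(1 / 2) : ℝ), K ^ (-(1 / 2) : ℝ)) ∘ₗ Φ.toLinearMap ∘ₗ
      LinearMap.mulLeftRight ℂ (A ^ (1 / 2 : ℝ), A ^ (1 / 2 : ℝ)))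
    (fun x hx => hKs.conjugate_nonneg (Φ.map_nonneg (hAs.conjugate_nonneg hx)))
  have hΨ : ∀ x, Ψ x = K ^ (-(1 / 2) : ℝ) * Φ (A ^ (1 / 2 : ℝ) * x * A ^ (1 / 2 : ℝ)) *
      K ^ (-(1 / 2) : ℝ) := fun x => rfl
  have hΨ1 : Ψ 1 = 1 := by
    rw [hΨ, mul_one, rpow_half_mul_rpow_half hA, ← hKdef, CFC.conjugate_rpow_neg_one_half K hK]
  have h1 := CFC.rpow_mul_rpow_neg (1 / 2) hK
  have h2 := CFC.rpow_neg_mul_rpow (1 / 2) hK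
  have hX : Ψ (A ^ (-(1 / 2) : ℝ) * B * A ^ (-(1 / 2) : ℝ)) =
      K ^ (-(1 / 2) : ℝ) * Φ B * K ^ (-(1 / 2) : ℝ) := by
    have h3 := opMean_one hA hB
    rw [opMean, CFC.rpow_one _ (isStrictlyPositive_conjugate_rpow hA hB _).nonneg] at h3
    rw [hΨ, h3]
  have key := map_rpow_le_rpow_map hΨ1 (isStrictlyPositive_conjugate_rpow hA hB (-(1 / 2))) hv
  rw [hX] at key
  have key2 := hKs'.conjugate_le_conjugate key
  refine le_trans (le_of_eq ?_) key2
  rw [hΨ, ← opMean]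
  calc Φ (opMean v A B) = (K ^ (1 / 2 : ℝ) * K ^ (-(1 / 2) : ℝ)) * Φ (opMean v A B) *
        (K ^ (-(1 / 2) : ℝ) * K ^ (1 / 2 : ℝ)) := by rw [h1, h2, one_mul, mul_one]
    _ = _ := by simp only [mul_assoc]

lemma Filter.Tendsto.opMean {ι : Type*} {l : Filter ι} {P Q : ι → H →L[ℂ] H} {w : ι → ℝ} {w₀ : ℝ}
    (hw : Tendsto w l (𝓝 w₀)) (hP : Tendsto P l (𝓝 A)) (hQ : Tendsto Q l (𝓝 B))
    (hP' : ∀ᶠ i in l, IsStrictlyPositive (P i)) (hQ' : ∀ᶠ i in l, IsStrictlyPositive (Q i))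
    (hA : IsStrictlyPositive A) (hB : IsStrictlyPositive B) :
    Tendsto (fun i => opMean (w i) (P i) (Q i)) l (𝓝 (opMean w₀ A B)) := by
  have h : ∀ y : ℝ, Tendsto (fun i => P i ^ y) l (𝓝 (A ^ y)) := fun y =>
    hP.cfcRpow hP' hA tendsto_const_nhds
  refine ((h _).mul (Tendsto.cfcRpow (((h _).mul hQ).mul (h _)) ?_
    (isStrictlyPositive_conjugate_rpow hA hB _) hw)).mul (h _)
  filter_upwards [hP', hQ'] with i h1 h2 using isStrictlyPositive_conjugate_rpow h1 h2 _

lemma Filter.Tendsto.inv_smul_opMean_sub {P Q : ℝ → H →L[ℂ] H} (c : ℝ)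
    (hP : Tendsto P (𝓝[>] 0) (𝓝 A)) (hQ : Tendsto Q (𝓝[>] 0) (𝓝 B))
    (hP' : ∀ᶠ v in 𝓝[>] 0, IsStrictlyPositive (P v))
    (hQ' : ∀ᶠ v in 𝓝[>] 0, IsStrictlyPositive (Q v))
    (hA : IsStrictlyPositive A) (hB : IsStrictlyPositive B) :
    Tendsto (fun v : ℝ => v⁻¹ • (_root_.opMean (c * v) (P v) (Q v) - P v)) (𝓝[>] 0)
      (𝓝 (c • relOpEntropy A B)) := by
  have h : ∀ y : ℝ, Tendsto (fun i => P i ^ y) (𝓝[>] 0) (𝓝 (A ^ y)) := fun y =>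
    hP.cfcRpow hP' hA tendsto_const_nhds
  have hX := Tendsto.inv_smul_rpow_sub_one c (((h (-(1 / 2))).mul hQ).mul (h (-(1 / 2))))
    (by filter_upwards [hP', hQ'] with i h1 h2 using isStrictlyPositive_conjugate_rpow h1 h2 _)
    (isStrictlyPositive_conjugate_rpow hA hB _)
  have := ((h (1 / 2)).mul hX).mul (h (1 / 2))
  rw [mul_smul_comm, smul_mul_assoc] at this
  refine this.congr' ?_
  filter_upwards [hP'] with v hv
  rw [mul_smul_comm, smul_mul_assoc, mul_sub, sub_mul, mul_one, rpow_half_mul_rpow_half hv,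
    _root_.opMean]

lemma Filter.Tendsto.relOpEntropy {ι : Type*} {l : Filter ι} {P Q : ι → H →L[ℂ] H}
    (hP : Tendsto P l (𝓝 A)) (hQ : Tendsto Q l (𝓝 B))
    (hP' : ∀ᶠ i in l, IsStrictlyPositive (P i)) (hQ' : ∀ᶠ i in l, IsStrictlyPositive (Q i))
    (hA : IsStrictlyPositive A) (hB : IsStrictlyPositive B) :
    Tendsto (fun i => relOpEntropy (P i) (Q i)) l (𝓝 (relOpEntropy A B)) := by
  have h : ∀ y : ℝ, Tendsto (fun i => P i ^ y) l (𝓝 (A ^ y)) := fun y =>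
    hP.cfcRpow hP' hA tendsto_const_nhds
  refine ((h _).mul (Tendsto.cfcLog (((h _).mul hQ).mul (h _)) ?_
    (isStrictlyPositive_conjugate_rpow hA hB _))).mul (h _)
  filter_upwards [hP', hQ'] with i h1 h2 using isStrictlyPositive_conjugate_rpow h1 h2 _

lemma tendsto_tsallisRelOpEntropy (hA : IsStrictlyPositive A) (hB : IsStrictlyPositive B) :
    Tendsto (fun v => tsallisRelOpEntropy v A B) (𝓝[>] 0) (𝓝 (relOpEntropy A B)) := by
  have := Filter.Tendsto.inv_smul_opMean_sub 1 (tendsto_const_nhds (x := A))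
    (tendsto_const_nhds (x := B)) (Eventually.of_forall fun _ => hA)
    (Eventually.of_forall fun _ => hB) hA hB
  rw [one_smul] at this
  refine this.congr' ?_
  filter_upwards [self_mem_nhdsWithin] with v hv
  rw [tsallisRelOpEntropy, if_neg (ne_of_gt hv), one_mul]

end OpMean

/-! ### Bounds, continuity and limit of the integrand. -/

section Integrand

variable {H : Type*} [NormedAddCommGroup H] [InnerProductSpace ℂ H] [CompleteSpace H]
  {A B : H →L[ℂ] H} {Φ : (H →L[ℂ] H) →ₚ[ℂ] (H →L[ℂ] H)}

lemma entropyIntegrand_eq (hA : IsStrictlyPositive A) (hB : IsStrictlyPositive B) (v μ : ℝ) :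
    entropyIntegrand Φ A B v μ = v⁻¹ • (opMean v (Φ (opMean (v * (1 - μ)) A B))
      (Φ (opMean (v + μ * (1 - v)) A B)) - Φ A) := by
  rw [entropyIntegrand, opMean_opMean_left hA hB, opMean_opMean_right hA hB]

lemma map_tsallisRelOpEntropy_le_entropyIntegrand (hΦ : Φ 1 = 1) (hA : IsStrictlyPositive A)
    (hB : IsStrictlyPositive B) {v : ℝ} (hv : v ∈ Ioc (0 : ℝ) 1) (μ : ℝ) :
    Φ (tsallisRelOpEntropy v A B) ≤ entropyIntegrand Φ A B v μ := by
  rw [tsallisRelOpEntropy, if_neg hv.1.ne', Φ.map_smul_of_tower, map_sub,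
    entropyIntegrand_eq hA hB]
  refine smul_le_smul_of_nonneg_left (sub_le_sub_right ?_ _) (inv_nonneg.2 hv.1.le)
  have := PositiveLinearMap.map_opMean_le hΦ (isStrictlyPositive_opMean hA hB (v * (1 - μ)))
    (isStrictlyPositive_opMean hA hB (v + μ * (1 - v))) (Ioc_subset_Icc_self hv)
  rw [opMean_opMean_opMean hA hB] at this
  -- The parameter `s + v(t - s)` collapses to `v`: the dependence on `μ` cancels.
  convert this using 3
  ring

lemma entropyIntegrand_le_tsallisRelOpEntropy (hΦ : Φ 1 = 1) (hA : IsStrictlyPositive A)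
    (hB : IsStrictlyPositive B) {v μ : ℝ} (hv : v ∈ Ioc (0 : ℝ) 1) (hμ : μ ∈ Icc (0 : ℝ) 1) :
    entropyIntegrand Φ A B v μ ≤ tsallisRelOpEntropy v (Φ A) (Φ B) := by
  rw [tsallisRelOpEntropy, if_neg hv.1.ne', entropyIntegrand_eq hA hB]
  refine smul_le_smul_of_nonneg_left (sub_le_sub_right ?_ _) (inv_nonneg.2 hv.1.le)
  have hs : v * (1 - μ) ∈ Icc (0 : ℝ) 1 :=
    ⟨mul_nonneg hv.1.le (by linarith [hμ.2]), mul_le_one₀ hv.2 (by linarith [hμ.2])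
      (by linarith [hμ.1])⟩
  have ht : v + μ * (1 - v) ∈ Icc (0 : ℝ) 1 :=
    ⟨by nlinarith [hv.1, hv.2, hμ.1], by nlinarith [hv.2, hμ.2]⟩
  have hΦA := PositiveLinearMap.map_isStrictlyPositive hΦ hA
  have hΦB := PositiveLinearMap.map_isStrictlyPositive hΦ hB
  have := opMean_le_opMean
    (PositiveLinearMap.map_isStrictlyPositive hΦ (isStrictlyPositive_opMean hA hB _))
    (PositiveLinearMap.map_isStrictlyPositive hΦ (isStrictlyPositive_opMean hA hB _))
    (Ioc_subset_Icc_self hv) (PositiveLinearMap.map_opMean_le hΦ hA hB hs)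
    (PositiveLinearMap.map_opMean_le hΦ hA hB ht)
  rw [opMean_opMean_opMean hΦA hΦB] at this
  convert this using 2
  ring

/-- If `L ≤ F ≤ U`, then `‖F - L‖ ≤ ‖U - L‖`. The bound is free of `μ` and converges as `v → 0⁺`,
which supplies the dominating constant. -/
lemma norm_entropyIntegrand_le (hΦ : Φ 1 = 1) (hA : IsStrictlyPositive A)
    (hB : IsStrictlyPositive B) {v μ : ℝ} (hv : v ∈ Ioc (0 : ℝ) 1) (hμ : μ ∈ Icc (0 : ℝ) 1) :
    ‖entropyIntegrand Φ A B v μ‖ ≤ ‖Φ (tsallisRelOpEntropy v A B)‖ +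
      ‖tsallisRelOpEntropy v (Φ A) (Φ B) - Φ (tsallisRelOpEntropy v A B)‖ := by
  have h1 := map_tsallisRelOpEntropy_le_entropyIntegrand hΦ hA hB hv μ
  have h2 := entropyIntegrand_le_tsallisRelOpEntropy hΦ hA hB hv hμ
  have h3 := CStarAlgebra.norm_le_norm_of_nonneg_of_le (sub_nonneg.2 h1) (sub_le_sub_right h2 _)
  calc ‖entropyIntegrand Φ A B v μ‖ = ‖Φ (tsallisRelOpEntropy v A B) +
        (entropyIntegrand Φ A B v μ - Φ (tsallisRelOpEntropy v A B))‖ := by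
        rw [add_sub_cancel]
    _ ≤ _ := (norm_add_le _ _).trans (by gcongr)

lemma tendsto_map_opMean (hA : IsStrictlyPositive A) (hB : IsStrictlyPositive B) {ι : Type*}
    {l : Filter ι} {w : ι → ℝ} {w₀ : ℝ} (hw : Tendsto w l (𝓝 w₀)) :
    Tendsto (fun i => Φ (opMean (w i) A B)) l (𝓝 (Φ (opMean w₀ A B))) :=
  ((map_continuous Φ).tendsto _).comp (hw.opMean tendsto_const_nhds tendsto_const_nhds
    (Eventually.of_forall fun _ => hA) (Eventually.of_forall fun _ => hB) hA hB)

lemma continuous_entropyIntegrand (hΦ : Φ 1 = 1) (hA : IsStrictlyPositive A)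
    (hB : IsStrictlyPositive B) (v : ℝ) : Continuous fun μ => entropyIntegrand Φ A B v μ := by
  simp only [entropyIntegrand_eq hA hB]
  have hp : ∀ w, IsStrictlyPositive (Φ (opMean w A B)) := fun w =>
    PositiveLinearMap.map_isStrictlyPositive hΦ (isStrictlyPositive_opMean hA hB w)
  have h : Continuous fun μ =>
      opMean v (Φ (opMean (v * (1 - μ)) A B)) (Φ (opMean (v + μ * (1 - v)) A B)) := by
    refine continuous_iff_continuousAt.2 fun μ => ?_
    exact tendsto_const_nhds.opMean
      (tendsto_map_opMean hA hB (Continuous.tendsto (by fun_prop) μ))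
      (tendsto_map_opMean hA hB (Continuous.tendsto (by fun_prop) μ))
      (Eventually.of_forall fun _ => hp _) (Eventually.of_forall fun _ => hp _) (hp _) (hp _)
  exact (h.sub continuous_const).const_smul v⁻¹

/-- The limit of the integrand as `v → 0⁺`. -/
noncomputable def entropyIntegrandLimit (Φ : (H →L[ℂ] H) →ₚ[ℂ] (H →L[ℂ] H)) (A B : H →L[ℂ] H)
    (μ : ℝ) : H →L[ℂ] H :=
  relOpEntropy (Φ A) (Φ (opMean μ A B)) + (1 - μ) • Φ (relOpEntropy A B)

lemma continuous_entropyIntegrandLimit (hΦ : Φ 1 = 1) (hA : IsStrictlyPositive A)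
    (hB : IsStrictlyPositive B) : Continuous (entropyIntegrandLimit Φ A B) := by
  have hp : ∀ w, IsStrictlyPositive (Φ (opMean w A B)) := fun w =>
    PositiveLinearMap.map_isStrictlyPositive hΦ (isStrictlyPositive_opMean hA hB w)
  have hΦA := PositiveLinearMap.map_isStrictlyPositive hΦ hA
  refine Continuous.add ?_ (by fun_prop)
  exact continuous_iff_continuousAt.2 fun μ => tendsto_const_nhds.relOpEntropy
    (tendsto_map_opMean hA hB tendsto_id) (Eventually.of_forall fun _ => hΦA)
    (Eventually.of_forall fun _ => hp _) hΦA (hp _)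

lemma tendsto_entropyIntegrand (hΦ : Φ 1 = 1) (hA : IsStrictlyPositive A)
    (hB : IsStrictlyPositive B) (μ : ℝ) :
    Tendsto (fun v => entropyIntegrand Φ A B v μ) (𝓝[>] 0)
      (𝓝 (entropyIntegrandLimit Φ A B μ)) := by
  have hp : ∀ w, IsStrictlyPositive (Φ (opMean w A B)) := fun w =>
    PositiveLinearMap.map_isStrictlyPositive hΦ (isStrictlyPositive_opMean hA hB w)
  have hΦA := PositiveLinearMap.map_isStrictlyPositive hΦ hA
  have hs : Tendsto (fun v : ℝ => v * (1 - μ)) (𝓝[>] 0) (𝓝 0) :=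
    (Continuous.tendsto' (by fun_prop) 0 0 (by simp)).mono_left nhdsWithin_le_nhds
  have ht : Tendsto (fun v : ℝ => v + μ * (1 - v)) (𝓝[>] 0) (𝓝 μ) :=
    (Continuous.tendsto' (by fun_prop) 0 μ (by simp)).mono_left nhdsWithin_le_nhds
  have hP : Tendsto (fun v => Φ (opMean (v * (1 - μ)) A B)) (𝓝[>] 0) (𝓝 (Φ A)) := by
    simpa only [opMean_zero hA hB] using tendsto_map_opMean (Φ := Φ) hA hB hs
  -- With `P = Φ(A ♯ₛ B)`, `s = v(1 - μ)`, the numerator is split as `(P ♯ᵥ Q - P) + (P - Φ(A))`;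
  -- the second term yields the factor `1 - μ`.
  have h1 := hP.inv_smul_opMean_sub 1 (tendsto_map_opMean hA hB ht)
    (Eventually.of_forall fun _ => hp _) (Eventually.of_forall fun _ => hp _) hΦA (hp _)
  have h2 := ((map_continuous Φ).tendsto _).comp
    ((tendsto_const_nhds (x := A)).inv_smul_opMean_sub (1 - μ) (tendsto_const_nhds (x := B))
      (Eventually.of_forall fun _ => hA) (Eventually.of_forall fun _ => hB) hA hB)
  have h3 := h1.add h2
  rw [one_smul, Φ.map_smul_of_tower] at h3
  refine h3.congr fun v => ?_
  rw [entropyIntegrand_eq hA hB, Function.comp, Φ.map_smul_of_tower, map_sub, ← smul_add, one_mul,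
    mul_comm (1 - μ), sub_add_sub_cancel]

lemma intervalIntegral.le_integral_zero_one {E : Type*} [NormedAddCommGroup E] [NormedSpace ℝ E]
    [CompleteSpace E] [PartialOrder E] [IsOrderedAddMonoid E] [IsOrderedModule ℝ E]
    [ClosedIciTopology E] {f : ℝ → E} {c : E} (hf : IntervalIntegrable f volume 0 1)
    (h : ∀ μ ∈ Icc (0 : ℝ) 1, c ≤ f μ) : c ≤ ∫ μ in (0 : ℝ)..1, f μ := by
  have hc : ∫ _ in (0 : ℝ)..1, c = c := by simp
  rw [← hc, intervalIntegral.integral_of_le zero_le_one,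
    intervalIntegral.integral_of_le zero_le_one]
  exact setIntegral_mono_on (by simp) hf.1 measurableSet_Ioc
    fun μ hμ => h μ (Ioc_subset_Icc_self hμ)

lemma intervalIntegral.integral_zero_one_le {E : Type*} [NormedAddCommGroup E] [NormedSpace ℝ E]
    [CompleteSpace E] [PartialOrder E] [IsOrderedAddMonoid E] [IsOrderedModule ℝ E]
    [ClosedIciTopology E] {f : ℝ → E} {c : E} (hf : IntervalIntegrable f volume 0 1)
    (h : ∀ μ ∈ Icc (0 : ℝ) 1, f μ ≤ c) : ∫ μ in (0 : ℝ)..1, f μ ≤ c := by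
  have hc : ∫ _ in (0 : ℝ)..1, c = c := by simp
  rw [← hc, intervalIntegral.integral_of_le zero_le_one,
    intervalIntegral.integral_of_le zero_le_one]
  exact setIntegral_mono_on hf.1 (by simp) measurableSet_Ioc
    fun μ hμ => h μ (Ioc_subset_Icc_self hμ)

end Integrand

/-- The case `v = 0` is the limit `v → 0⁺`: the integrand converges, for every `μ ∈ [0,1]`, to
some `G μ`, its integral converges to the integral of `G`, and the integral of `G` satisfies the
two inequalities. Integrals are Bochner integrals in the operator norm. -/
theorem theorem3 {H : Type*} [NormedAddCommGroup H] [InnerProductSpace ℂ H] [CompleteSpace H]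
    (A B : H →L[ℂ] H) (hA : IsStrictlyPositive A) (hB : IsStrictlyPositive B)
    (Φ : (H →L[ℂ] H) →ₚ[ℂ] (H →L[ℂ] H)) (hΦ : Φ 1 = 1) :
    (∀ v ∈ Ioc (0 : ℝ) 1,
      IntervalIntegrable (fun μ : ℝ => entropyIntegrand Φ A B v μ) volume 0 1 ∧
      Φ (tsallisRelOpEntropy v A B) ≤ (∫ μ in (0 : ℝ)..1, entropyIntegrand Φ A B v μ) ∧
      (∫ μ in (0 : ℝ)..1, entropyIntegrand Φ A B v μ) ≤ tsallisRelOpEntropy v (Φ A) (Φ B)) ∧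
    (∃ G : ℝ → (H →L[ℂ] H),
      (∀ μ ∈ Icc (0 : ℝ) 1,
        Tendsto (fun v : ℝ => entropyIntegrand Φ A B v μ) (𝓝[>] 0) (𝓝 (G μ))) ∧
      IntervalIntegrable G volume 0 1 ∧
      Tendsto (fun v : ℝ => ∫ μ in (0 : ℝ)..1, entropyIntegrand Φ A B v μ) (𝓝[>] 0)
        (𝓝 (∫ μ in (0 : ℝ)..1, G μ)) ∧
      Φ (tsallisRelOpEntropy 0 A B) ≤ (∫ μ in (0 : ℝ)..1, G μ) ∧
      (∫ μ in (0 : ℝ)..1, G μ) ≤ tsallisRelOpEntropy 0 (Φ A) (Φ B)) := by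
  have hΦA := PositiveLinearMap.map_isStrictlyPositive hΦ hA
  have hΦB := PositiveLinearMap.map_isStrictlyPositive hΦ hB
  have hint : ∀ v, IntervalIntegrable (fun μ : ℝ => entropyIntegrand Φ A B v μ) volume 0 1 :=
    fun v => (continuous_entropyIntegrand hΦ hA hB v).intervalIntegrable 0 1
  have hv01 : ∀ᶠ v : ℝ in 𝓝[>] 0, v ∈ Ioc (0 : ℝ) 1 := Ioc_mem_nhdsGT one_pos
  have hL : Tendsto (fun v => Φ (tsallisRelOpEntropy v A B)) (𝓝[>] 0)
      (𝓝 (Φ (relOpEntropy A B))) :=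
    ((map_continuous Φ).tendsto _).comp (tendsto_tsallisRelOpEntropy hA hB)
  have hU := tendsto_tsallisRelOpEntropy hΦA hΦB
  have hlower : ∀ v ∈ Ioc (0 : ℝ) 1,
      Φ (tsallisRelOpEntropy v A B) ≤ ∫ μ in (0 : ℝ)..1, entropyIntegrand Φ A B v μ :=
    fun v hv => intervalIntegral.le_integral_zero_one (hint v) fun μ _ =>
      map_tsallisRelOpEntropy_le_entropyIntegrand hΦ hA hB hv μ
  have hupper : ∀ v ∈ Ioc (0 : ℝ) 1,
      (∫ μ in (0 : ℝ)..1, entropyIntegrand Φ A B v μ) ≤ tsallisRelOpEntropy v (Φ A) (Φ B) :=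
    fun v hv => intervalIntegral.integral_zero_one_le (hint v) fun μ hμ =>
      entropyIntegrand_le_tsallisRelOpEntropy hΦ hA hB hv hμ
  have hconv : Tendsto (fun v : ℝ => ∫ μ in (0 : ℝ)..1, entropyIntegrand Φ A B v μ) (𝓝[>] 0)
      (𝓝 (∫ μ in (0 : ℝ)..1, entropyIntegrandLimit Φ A B μ)) := by
    have hN := hL.norm.add (hU.sub hL).norm
    set C := ‖Φ (relOpEntropy A B)‖ + ‖relOpEntropy (Φ A) (Φ B) - Φ (relOpEntropy A B)‖
    refine intervalIntegral.tendsto_integral_filter_of_dominated_convergence (fun _ => C + 1)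
      (Eventually.of_forall fun v =>
        (continuous_entropyIntegrand hΦ hA hB v).aestronglyMeasurable) ?_
      intervalIntegrable_const
      (Eventually.of_forall fun μ _ => tendsto_entropyIntegrand hΦ hA hB μ)
    filter_upwards [hv01, hN.eventually_le_const (lt_add_one C)] with v hv hvC
    refine Eventually.of_forall fun μ hμ => (norm_entropyIntegrand_le hΦ hA hB hv ?_).trans hvC
    rw [uIoc_of_le zero_le_one] at hμ
    exact Ioc_subset_Icc_self hμ
  refine ⟨fun v hv => ⟨hint v, hlower v hv, hupper v hv⟩, entropyIntegrandLimit Φ A B,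
    fun μ _ => tendsto_entropyIntegrand hΦ hA hB μ,
    (continuous_entropyIntegrandLimit hΦ hA hB).intervalIntegrable 0 1, hconv, ?_, ?_⟩
  · rw [tsallisRelOpEntropy, if_pos rfl]
    exact le_of_tendsto_of_tendsto hL hconv (hv01.mono hlower)
  · rw [tsallisRelOpEntropy, if_pos rfl]
    exact le_of_tendsto_of_tendsto hconv hU (hv01.mono hupper)
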